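/- Let $d\ge 0$ and let $\mathbb{R}_d$ be the real Clifford algebra generated by $e_1,\dots,e_d$ with $e_i^2=-1$ and $e_ie_j=-e_je_i$ for $i\ne j$, with basis $e_A=e_{i_1}\cdots e_{i_r}$ for $A=\{i_1<\dots<i_r\}\subseteq\{1,\dots,d\}$. For $s=\sum_A s_Ae_A$ put $\overline{s}=\sum_A(-1)^{|A|(|A|+1)/2}s_Ae_A$, $|s|^2=\sum_A s_A^2$, and $\operatorname{Sc}(s)=s_0=s_\emptyset$. Let $\mathbb{R}^{d+1}\subseteq\mathbb{R}_d$ be the set of paravectors $s_0+s_1e_1+\dots+s_de_d$ with real $s_0,\dots,s_d$. Let $V_{\mathbb{R}}$ be a real Hilbert space and let $V=V_{\mathbb{R}}\otimes\mathbb{R}_d=\{\sum_A v_A\otimes e_A : v_A\in V_{\mathbb{R}}\}$ be the Hilbert module over $\mathbb{R}_d$ with multiplications $sv=\sum_A v_A\otimes(se_A)$ and $vs=\sum_A v_A\otimes(e_As)$, inner product $\langle v,w\rangle=\sum_{A,B}\langle v_A,w_B\rangle_{\mathbb{R}}\,\overline{e_A}e_B$, and norm $\|v\|^2=\operatorname{Sc}\langle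 v,v\rangle=\sum_A\|v_A\|^2$. A partially defined $\mathbb{R}$-linear operator $T:\operatorname{dom}(T)\subseteq V\to V$ is right-linear if $vs\in\operatorname{dom}(T)$ and $T(vs)=(Tv)s$ for all $v\in\operatorname{dom}(T)$, $s\in\mathbb{R}_d$. Let $\mathcal{K}(V)$ be the set of closed right-linear operators, and $\mathcal{B}(V)$ the set of bounded right-linear operators with domain $V$. Sums and products of operators are taken on their natural domains, and $s\in\mathbb{R}_d$ also denotes the operator $v\mapsto sv$. For a paravector $s$ set $Q_s[T]=T^2-2s_0T+|s|^2$ on $\operatorname{dom}(T^2)$. The $S$-resolvent set is $$\rho_S(T)=\{s\in\mathbb{R}^{d+1} : Q_s[T]\text{ is injective and }Q_s[T]^{-1}\in\mathcal{B}(V)\},$$ and the $S$-spectrum is $\sigma_S(T)=\mathbb{R}^{d+1}\setminus\rho_S(T)$. For $s\in\rho_S(T)$ the left and right $S$-resolvent operators are $$S_L^{-1}(s,T)=Q_s[T]^{-1}\overline{s}-TQ_s[T]^{-1},\qquad S_R^{-1}(s,T)=(\overline{s}-T)Q_s[T]^{-1}.$$ The adjoint $T^*$ of a densely defined operator $T$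 has as domain the set of all $w\in V$ for which there is $v_w\in V$ with $\operatorname{Sc}\langle v_w,v\rangle=\operatorname{Sc}\langle w,Tv\rangle$ for all $v\in\operatorname{dom}(T)$, and $T^*w=v_w$. **Theorem.** Let $T\in\mathcal{K}(V)$ be densely defined. Then $$\sigma_S(T^*)=\sigma_S(T).$$ Moreover, for every $s\in\rho_S(T^*)$ one has $\overline{s}\in\rho_S(T)$ and $$S_L^{-1}(s,T^*)=S_R^{-1}(\overline{s},T)^*\qquad\text{and}\qquad S_R^{-1}(s,T^*)=S_L^{-1}(\overline{s},T)^*.$$ -/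

import Mathlib

noncomputable section

namespace CliffordS

/-! ### The real Clifford algebra with `d` imaginary units -/

/-- The negative definite quadratic form `x ↦ -(x₁² + ⋯ + x_d²)` on `ℝ^d`. -/
def negSq (d : ℕ) : QuadraticForm ℝ (Fin d → ℝ) :=
  QuadraticMap.weightedSumSquares ℝ (fun _ : Fin d => (-1 : ℝ))

/-- The real Clifford algebra `ℝ_d`. Its conjugation is `star` (Clifford conjugation). -/
abbrev Cl (d : ℕ) : Type := CliffordAlgebra (negSq d)

/-- The imaginary unit `e_i`. -/
def unit {d : ℕ} (i : Fin d) : Cl d := CliffordAlgebra.ι (negSq d) (Pi.single i 1)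

/-- The basis vector `e_A = e_{i₁} ⋯ e_{i_r}` for `A = {i₁ < ⋯ < i_r}`. -/
def unitProd {d : ℕ} (A : Finset (Fin d)) : Cl d := (A.sort.map unit).prod

lemma negSq_apply {d : ℕ} (x : Fin d → ℝ) : negSq d x = -∑ i, x i * x i := by
  simp [negSq, QuadraticMap.weightedSumSquares_apply]

lemma ι_eq_sum {d : ℕ} (x : Fin d → ℝ) :
    CliffordAlgebra.ι (negSq d) x = ∑ i, x i • unit i := by
  conv_lhs => rw [pi_eq_sum_univ x]
  simp only [map_sum, map_smul, unit]
  refine Finset.sum_congr rfl fun i _ => ?_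
  congr 2
  funext j
  simp [Pi.single_apply, eq_comm]

lemma unit_mul_self {d : ℕ} (i : Fin d) : unit i * unit i = (-1 : Cl d) := by
  rw [unit, CliffordAlgebra.ι_sq_scalar, negSq_apply]
  simp [Pi.single_apply]

lemma unit_mul_unit {d : ℕ} {i j : Fin d} (h : i ≠ j) :
    unit i * unit j = -(unit j * unit i : Cl d) := by
  have h1 := CliffordAlgebra.ι_sq_scalar (negSq d) (Pi.single i 1 + Pi.single j 1)
  have h2 : negSq d (Pi.single i 1 + Pi.single j 1) = -2 := by
    have hk : ∀ k : Fin d, (Pi.single i (1 : ℝ) + Pi.single j 1 : Fin d → ℝ) k *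
        (Pi.single i (1 : ℝ) + Pi.single j 1 : Fin d → ℝ) k
        = (if k = i then 1 else 0) + (if k = j then 1 else 0) := by
      intro k
      by_cases hi : k = i
      · subst hi; simp [h]
      · by_cases hj : k = j
        · subst hj; simp [hi]
        · simp [hi, hj]
    rw [negSq_apply, Finset.sum_congr rfl fun k _ => hk k, Finset.sum_add_distrib]
    simp; norm_num
  rw [h2, map_add] at h1
  have h3 : (unit i + unit j) * (unit i + unit j) = (-2 : Cl d) := by
    simpa [unit, map_ofNat] using h1
  rw [add_mul, mul_add, mul_add, unit_mul_self, unit_mul_self] at h3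
  have h4 : unit i * unit j + unit j * unit i = (0 : Cl d) := by
    have h5 : (-1 : Cl d) + unit i * unit j + (unit j * unit i + -1) + 2 = 0 := by
      rw [h3]; abel
    rw [← h5]
    have : (2 : Cl d) = 1 + 1 := by norm_num
    rw [this]; abel
  exact eq_neg_of_add_eq_zero_left h4

lemma unitProd_empty {d : ℕ} : unitProd (∅ : Finset (Fin d)) = 1 := by
  simp [unitProd]

lemma unitProd_insert {d : ℕ} {i : Fin d} {A : Finset (Fin d)} (h : ∀ j ∈ A, i < j) :
    unitProd (insert i A) = unit i * unitProd A := by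
  have hi : i ∉ A := fun hA => lt_irrefl _ (h i hA)
  rw [unitProd, Finset.sort_insert (fun a b => a ≤ b) (fun j hj => (h j hj).le) hi]
  simp [unitProd]

/-- The sign `ε` in `e_i e_A = ε e_{A ∆ {i}}`. -/
def unitSign {d : ℕ} (i : Fin d) (A : Finset (Fin d)) : ℝ :=
  (-1) ^ (A.filter (fun j => j ≤ i)).card

lemma unit_mul_unitProd {d : ℕ} (i : Fin d) (A : Finset (Fin d)) :
    unit i * unitProd A = unitSign i A • unitProd (symmDiff A {i}) := by
  induction A using Finset.induction_on_min with
  | empty =>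
    have h := unitProd_insert (i := i) (A := ∅) (by simp)
    rw [← h]
    simp [unitSign, symmDiff]
  | insert a A ha ih =>
    have haA : a ∉ A := fun h => lt_irrefl _ (ha a h)
    rcases lt_trichotomy i a with hia | rfl | hia
    · have h1 : ∀ j ∈ insert a A, i < j := by
        intro j hj
        rcases Finset.mem_insert.1 hj with rfl | hj
        · exact hia
        · exact hia.trans (ha j hj)
      have h2 : symmDiff (insert a A) {i} = insert i (insert a A) := by
        ext k
        have := h1 k
        simp only [Finset.mem_symmDiff, Finset.mem_singleton, Finset.mem_insert] at this ⊢
        grind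
      have h3 : (insert a A).filter (fun j => j ≤ i) = ∅ := by
        ext k
        have := h1 k
        simp only [Finset.mem_filter, Finset.notMem_empty, iff_false, not_and, not_le]
        exact this
      rw [h2, unitProd_insert h1, unitSign, h3]
      simp
    · have h2 : symmDiff (insert i A) {i} = A := by
        ext k
        simp only [Finset.mem_symmDiff, Finset.mem_singleton, Finset.mem_insert]
        grind
      have h3 : (insert i A).filter (fun j => j ≤ i) = {i} := by
        ext k
        have := ha k
        simp only [Finset.mem_filter, Finset.mem_singleton, Finset.mem_insert]
        grind
      rw [h2, unitSign, h3, unitProd_insert ha, ← mul_assoc, unit_mul_self]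
      simp
    · have h2 : symmDiff (insert a A) {i} = insert a (symmDiff A {i}) := by
        ext k
        simp only [Finset.mem_symmDiff, Finset.mem_singleton, Finset.mem_insert]
        grind
      have h3 : (insert a A).filter (fun j => j ≤ i) = insert a (A.filter (fun j => j ≤ i)) := by
        ext k
        simp only [Finset.mem_filter, Finset.mem_insert]
        grind
      have h4 : ∀ j ∈ symmDiff A {i}, a < j := by
        intro j hj
        have := ha j
        simp only [Finset.mem_symmDiff, Finset.mem_singleton] at hj
        grind
      rw [h2, unitSign, h3, unitProd_insert ha, unitProd_insert h4,
        Finset.card_insert_of_notMem (by simp [haA]), ← mul_assoc, unit_mul_unit hia.ne',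
        neg_mul, mul_assoc, ih, unitSign, mul_smul_comm, pow_succ]
      simp

/-- Left multiplication by `e_i`, read on coordinates with respect to the `e_A`. -/
def unitAct {d : ℕ} (i : Fin d) : (Finset (Fin d) → ℝ) →ₗ[ℝ] (Finset (Fin d) → ℝ) where
  toFun f A := unitSign i (symmDiff A {i}) * f (symmDiff A {i})
  map_add' f g := by funext A; simp [mul_add]
  map_smul' c f := by funext A; simp; ring

lemma unitAct_unitAct_self {d : ℕ} (i : Fin d) (f : Finset (Fin d) → ℝ) :
    unitAct i (unitAct i f) = -f := by
  funext A
  have h1 : symmDiff (symmDiff A {i}) {i} = A := symmDiff_symmDiff_cancel_right _ _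
  have h2 : unitSign i (symmDiff A {i}) * unitSign i A = -1 := by
    unfold unitSign
    by_cases h : i ∈ A
    · have : A.filter (fun j => j ≤ i) =
          insert i ((symmDiff A {i}).filter (fun j => j ≤ i)) := by
        ext k; simp [Finset.mem_symmDiff]; grind
      rw [this, Finset.card_insert_of_notMem (by simp [Finset.mem_symmDiff, h]), pow_succ,
        ← mul_assoc, ← pow_add, Even.neg_one_pow ⟨_, rfl⟩]
      simp
    · have : (symmDiff A {i}).filter (fun j => j ≤ i) =
          insert i (A.filter (fun j => j ≤ i)) := by
        ext k; simp [Finset.mem_symmDiff]; grind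
      rw [this, Finset.card_insert_of_notMem (by simp [h]), pow_succ, mul_right_comm,
        ← pow_add, Even.neg_one_pow ⟨_, rfl⟩]
      simp
  simp only [unitAct, LinearMap.coe_mk, AddHom.coe_mk, h1, Pi.neg_apply]
  rw [← mul_assoc, h2]; ring

lemma unitSign_symmDiff_lt {d : ℕ} {i j : Fin d} (h : i < j) (A : Finset (Fin d)) :
    unitSign i (symmDiff A {j}) = unitSign i A := by
  unfold unitSign
  congr 2
  ext k; simp [Finset.mem_symmDiff]; grind

lemma unitSign_symmDiff_gt {d : ℕ} {i j : Fin d} (h : j < i) (A : Finset (Fin d)) :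
    unitSign i (symmDiff A {j}) = -unitSign i A := by
  unfold unitSign
  by_cases hj : j ∈ A
  · have : A.filter (fun k => k ≤ i) =
        insert j ((symmDiff A {j}).filter (fun k => k ≤ i)) := by
      ext k; simp [Finset.mem_symmDiff]; grind
    rw [this, Finset.card_insert_of_notMem (by simp [Finset.mem_symmDiff, hj]), pow_succ]
    simp
  · have : (symmDiff A {j}).filter (fun k => k ≤ i) =
        insert j (A.filter (fun k => k ≤ i)) := by
      ext k; simp [Finset.mem_symmDiff]; grind
    rw [this, Finset.card_insert_of_notMem (by simp [hj]), pow_succ]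
    simp

lemma unitAct_unitAct_lt {d : ℕ} {i j : Fin d} (h : i < j) (f : Finset (Fin d) → ℝ) :
    unitAct i (unitAct j f) = -unitAct j (unitAct i f) := by
  funext A
  have h1 : symmDiff (symmDiff A {i}) {j} = symmDiff (symmDiff A {j}) {i} :=
    symmDiff_right_comm _ _ _
  simp only [unitAct, LinearMap.coe_mk, AddHom.coe_mk, Pi.neg_apply, h1]
  rw [unitSign_symmDiff_gt h (symmDiff A {j}), ← h1, unitSign_symmDiff_lt h (symmDiff A {i})]
  ring

lemma unitAct_unitAct {d : ℕ} {i j : Fin d} (h : i ≠ j) (f : Finset (Fin d) → ℝ) :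
    unitAct i (unitAct j f) = -unitAct j (unitAct i f) := by
  rcases lt_or_gt_of_ne h with h | h
  · exact unitAct_unitAct_lt h f
  · rw [unitAct_unitAct_lt h f, neg_neg]

/-- The action of the Clifford algebra on coordinates by left multiplication. -/
def coordRep (d : ℕ) : Cl d →ₐ[ℝ] Module.End ℝ (Finset (Fin d) → ℝ) :=
  CliffordAlgebra.lift (negSq d)
    ⟨∑ i, (LinearMap.proj (R := ℝ) (φ := fun _ : Fin d => ℝ) i).smulRight (unitAct i), by
      intro x
      have key : ∀ i j : Fin d,
          (x i • unitAct i : Module.End ℝ (Finset (Fin d) → ℝ)) * (x j • unitAct j)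
          + (x j • unitAct j : Module.End ℝ (Finset (Fin d) → ℝ)) * (x i • unitAct i)
          = if i = j then algebraMap ℝ _ (-2 * (x i * x i)) else 0 := by
        intro i j
        split_ifs with h
        · subst h
          refine LinearMap.ext fun f => ?_
          simp only [LinearMap.add_apply, Module.End.mul_apply, LinearMap.smul_apply, map_smul,
            unitAct_unitAct_self, Module.algebraMap_end_apply, smul_smul]
          module
        · refine LinearMap.ext fun f => ?_
          simp [unitAct_unitAct h, smul_smul, mul_comm]
      have hS : (∑ i, (LinearMap.proj (R := ℝ) (φ := fun _ : Fin d => ℝ) i).smulRight (unitAct i)) x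
          = ∑ i, (x i • unitAct i : Module.End ℝ (Finset (Fin d) → ℝ)) := by
        simp [LinearMap.sum_apply]
      rw [hS]
      set S := ∑ i, (x i • unitAct i : Module.End ℝ (Finset (Fin d) → ℝ)) with hSdef
      have h2 : S * S + S * S = algebraMap ℝ _ (-2 * ∑ i, x i * x i) := by
        have e1 : S * S = ∑ i, ∑ j, (x i • unitAct i : Module.End ℝ (Finset (Fin d) → ℝ))
            * (x j • unitAct j) := by
          rw [hSdef, Finset.sum_mul_sum]
        have e2 : S * S = ∑ i, ∑ j, (x j • unitAct j : Module.End ℝ (Finset (Fin d) → ℝ))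
            * (x i • unitAct i) := by
          rw [e1, Finset.sum_comm]
        nth_rewrite 1 [e1]
        rw [e2, ← Finset.sum_add_distrib]
        simp only [← Finset.sum_add_distrib, key]
        simp [Finset.mul_sum]
      rw [← two_smul ℝ] at h2
      have h3 := congrArg (fun t => (2⁻¹ : ℝ) • t) h2
      simp only [smul_smul] at h3
      rw [inv_mul_cancel₀ two_ne_zero, one_smul] at h3
      rw [h3, negSq_apply, Algebra.algebraMap_eq_smul_one, Algebra.algebraMap_eq_smul_one, smul_smul]
      congr 1
      ring⟩

lemma coordRep_unit {d : ℕ} (i : Fin d) : coordRep d (unit i) = unitAct i := by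
  simp [coordRep, unit, LinearMap.sum_apply, Pi.single_apply]

lemma coordRep_unitProd {d : ℕ} (A : Finset (Fin d)) :
    coordRep d (unitProd A) (Pi.single ∅ 1) = Pi.single A 1 := by
  induction A using Finset.induction_on_min with
  | empty => simp [unitProd_empty]
  | insert a A ha ih =>
    have haA : a ∉ A := fun h => lt_irrefl _ (ha a h)
    rw [unitProd_insert ha, map_mul, Module.End.mul_apply, ih, coordRep_unit]
    funext B
    have h1 : symmDiff B {a} = A ↔ B = insert a A := by
      have : insert a A = symmDiff A {a} := by
        ext k; simp [Finset.mem_symmDiff]; grind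
      rw [this]
      constructor
      · rintro rfl; exact (symmDiff_symmDiff_cancel_right _ _).symm
      · rintro rfl; exact symmDiff_symmDiff_cancel_right _ _
    have h2 : A.filter (fun j => j ≤ a) = ∅ := by
      ext k
      have := ha k
      simp only [Finset.mem_filter, Finset.notMem_empty, iff_false, not_and, not_le]
      exact this
    by_cases hB : B = insert a A
    · have h3 := h1.2 hB
      simp only [unitAct, LinearMap.coe_mk, AddHom.coe_mk, h3, unitSign, h2]
      simp [hB]
    · have h3 : symmDiff B {a} ≠ A := fun h => hB (h1.1 h)
      simp only [unitAct, LinearMap.coe_mk, AddHom.coe_mk]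
      simp [hB, h3]

lemma unitProd_linearIndependent (d : ℕ) :
    LinearIndependent ℝ (unitProd : Finset (Fin d) → Cl d) := by
  have h := (Pi.basisFun ℝ (Finset (Fin d))).linearIndependent
  refine LinearIndependent.of_comp
    ((LinearMap.applyₗ (R := ℝ) (Pi.single ∅ 1 : Finset (Fin d) → ℝ)).comp
      (coordRep d).toLinearMap) ?_
  convert h using 1
  funext A
  simp [coordRep_unitProd]

lemma unitProd_span (d : ℕ) :
    ⊤ ≤ Submodule.span ℝ (Set.range (unitProd : Finset (Fin d) → Cl d)) := by
  set P := Submodule.span ℝ (Set.range (unitProd : Finset (Fin d) → Cl d)) with hP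
  have hunit : ∀ (i : Fin d) (b : Cl d), b ∈ P → unit i * b ∈ P := by
    intro i b hb
    induction hb using Submodule.span_induction with
    | mem b hb =>
      obtain ⟨A, rfl⟩ := hb
      rw [unit_mul_unitProd]
      exact P.smul_mem _ (Submodule.subset_span ⟨_, rfl⟩)
    | zero => simp
    | add b c _ _ hb hc => rw [mul_add]; exact P.add_mem hb hc
    | smul r b _ hb => rw [mul_smul_comm]; exact P.smul_mem _ hb
  have hmul : ∀ a b : Cl d, b ∈ P → a * b ∈ P := by
    intro a
    induction a using CliffordAlgebra.induction with
    | algebraMap r => intro b hb; rw [← Algebra.smul_def]; exact P.smul_mem _ hb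
    | ι x =>
      intro b hb
      rw [ι_eq_sum, Finset.sum_mul]
      refine P.sum_mem fun i _ => ?_
      rw [smul_mul_assoc]
      exact P.smul_mem _ (hunit i b hb)
    | mul a c ha hc => intro b hb; rw [mul_assoc]; exact ha _ (hc _ hb)
    | add a c ha hc => intro b hb; rw [add_mul]; exact P.add_mem (ha _ hb) (hc _ hb)
  intro a _
  have h1 : (1 : Cl d) ∈ P := Submodule.subset_span ⟨∅, unitProd_empty⟩
  simpa using hmul a 1 h1

/-- The basis `(e_A)_A` of `ℝ_d`, indexed by the subsets `A` of `{1, …, d}`. -/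
def eBasis (d : ℕ) : Module.Basis (Finset (Fin d)) ℝ (Cl d) :=
  Module.Basis.mk (unitProd_linearIndependent d) (unitProd_span d)

lemma eBasis_apply {d : ℕ} (A : Finset (Fin d)) : eBasis d A = unitProd A := by
  simp [eBasis]

/-- The coordinate `s_A` of `s = ∑ s_A e_A`. -/
def coord {d : ℕ} (A : Finset (Fin d)) (s : Cl d) : ℝ := (eBasis d).repr s A

/-- The scalar part `Sc(s) = s_∅`. -/
def Sc {d : ℕ} (s : Cl d) : ℝ := coord ∅ s

/-- The squared modulus `|s|² = ∑ s_A²`. -/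
def modSq {d : ℕ} (s : Cl d) : ℝ := ∑ A, coord A s ^ 2

/-- The paravectors `s₀ + s₁ e₁ + ⋯ + s_d e_d`, a copy of `ℝ^{d+1}` in `ℝ_d`. -/
def paravectors (d : ℕ) : Set (Cl d) :=
  {s | ∃ (s₀ : ℝ) (x : Fin d → ℝ), s = algebraMap ℝ (Cl d) s₀ + ∑ i, x i • unit i}

lemma star_unitProd_mul_self {d : ℕ} (A : Finset (Fin d)) :
    star (unitProd A) * unitProd A = (1 : Cl d) := by
  induction A using Finset.induction_on_min with
  | empty => simp [unitProd_empty]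
  | insert a A ha ih =>
    rw [unitProd_insert ha, star_mul, mul_assoc, ← mul_assoc (star (unit a))]
    have : star (unit a) * unit a = (1 : Cl d) := by
      have h : star (unit a : Cl d) = - unit a := by simp [unit]
      rw [h, neg_mul, unit_mul_self, neg_neg]
    rw [this, one_mul, ih]

lemma unitProd_mul_unit {d : ℕ} (i : Fin d) (A : Finset (Fin d)) (hi : i ∉ A) :
    unitProd A * unit i = (-1 : ℝ) ^ A.card • (unit i * unitProd A : Cl d) := by
  induction A using Finset.induction_on_min with
  | empty => simp [unitProd_empty]
  | insert a A ha ih =>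
    have haA : a ∉ A := fun h => lt_irrefl _ (ha a h)
    have hia : i ≠ a := fun h => hi (by simp [h])
    have hiA : i ∉ A := fun h => hi (by simp [h])
    rw [unitProd_insert ha, mul_assoc, ih hiA, Finset.card_insert_of_notMem haA, pow_succ,
      mul_smul_comm, ← mul_assoc, ← mul_assoc, unit_mul_unit hia]
    simp

/-- `conj (e_A) = (-1)^(|A| (|A| + 1) / 2) e_A`. -/
lemma star_unitProd {d : ℕ} (A : Finset (Fin d)) :
    star (unitProd A) = ((-1 : ℝ) ^ (A.card * (A.card + 1) / 2)) • (unitProd A : Cl d) := by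
  induction A using Finset.induction_on_min with
  | empty => simp [unitProd_empty]
  | insert a A ha ih =>
    have haA : a ∉ A := fun h => lt_irrefl _ (ha a h)
    have h : star (unit a : Cl d) = - unit a := by simp [unit]
    have h2 : (A.card + 1) * (A.card + 1 + 1) / 2 = A.card * (A.card + 1) / 2 + (A.card + 1) := by
      have : (A.card + 1) * (A.card + 1 + 1) = A.card * (A.card + 1) + (A.card + 1) * 2 := by ring
      rw [this, Nat.add_mul_div_right _ _ (by norm_num)]
    rw [unitProd_insert ha, star_mul, ih, h, mul_neg, smul_mul_assoc, unitProd_mul_unit a A haA,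
      Finset.card_insert_of_notMem haA, h2, smul_smul, pow_add, pow_succ]
    simp

lemma unitProd_mul_unitProd {d : ℕ} (A B : Finset (Fin d)) :
    ∃ c : ℝ, (unitProd A * unitProd B : Cl d) = c • unitProd (symmDiff A B) := by
  induction A using Finset.induction_on_min with
  | empty => exact ⟨1, by simp [unitProd_empty, symmDiff]⟩
  | insert a A ha ih =>
    obtain ⟨c, hc⟩ := ih
    have haA : a ∉ A := fun h => lt_irrefl _ (ha a h)
    refine ⟨c * unitSign a (symmDiff A B), ?_⟩
    have h1 : symmDiff (insert a A) B = symmDiff (symmDiff A B) {a} := by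
      ext k; simp [Finset.mem_symmDiff]; grind
    rw [unitProd_insert ha, mul_assoc, hc, mul_smul_comm, unit_mul_unitProd, smul_smul, h1]

lemma coord_unitProd {d : ℕ} (A B : Finset (Fin d)) :
    coord A (unitProd B) = if A = B then 1 else 0 := by
  rw [coord, ← eBasis_apply, Module.Basis.repr_self, Finsupp.single_apply]
  simp [eq_comm]

lemma Sc_star_unitProd_mul {d : ℕ} (A B : Finset (Fin d)) :
    Sc (star (unitProd A) * unitProd B : Cl d) = if A = B then 1 else 0 := by
  split_ifs with h
  · subst h
    rw [star_unitProd_mul_self, ← unitProd_empty, Sc, coord_unitProd]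
    simp
  · obtain ⟨c, hc⟩ := unitProd_mul_unitProd A B
    have h0 : (∅ : Finset (Fin d)) ≠ symmDiff A B := by
      intro h'
      exact h (symmDiff_eq_bot.1 h'.symm)
    rw [star_unitProd, smul_mul_assoc, hc, smul_smul, Sc]
    have h1 := coord_unitProd (∅ : Finset (Fin d)) (symmDiff A B)
    rw [if_neg h0] at h1
    simp only [coord, map_smul, Finsupp.smul_apply] at h1 ⊢
    rw [h1, smul_zero]

/-! ### The Hilbert module over `ℝ_d` -/

/-- The module `V = H ⊗ ℝ_d` over a real Hilbert space `H`. The family `v` stands for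
`∑ v_A ⊗ e_A`, and `‖v‖² = ∑ ‖v_A‖²`. -/
abbrev CMod (d : ℕ) (H : Type*) : Type _ := PiLp 2 (fun _ : Finset (Fin d) => H)

section Module

variable {d : ℕ} {H : Type*} [NormedAddCommGroup H] [InnerProductSpace ℝ H]

/-- The element `x ⊗ a` of `V`. -/
def tens (x : H) (a : Cl d) : CMod d H := WithLp.toLp 2 fun C => coord C a • x

/-- Left multiplication `v ↦ s v`, where `s v = ∑ v_A ⊗ (s e_A)`. -/
def leftMul (s : Cl d) : CMod d H →ₗ[ℝ] CMod d H where
  toFun v := ∑ A, tens (v A) (s * unitProd A)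
  map_add' v w := by
    rw [← Finset.sum_add_distrib]
    refine Finset.sum_congr rfl fun A _ => ?_
    ext C
    simp [tens]
  map_smul' r v := by
    rw [RingHom.id_apply, Finset.smul_sum]
    refine Finset.sum_congr rfl fun A _ => ?_
    ext C
    simp [tens, smul_comm r]

/-- Right multiplication `v ↦ v s`, where `v s = ∑ v_A ⊗ (e_A s)`. -/
def rightMul (s : Cl d) : CMod d H →ₗ[ℝ] CMod d H where
  toFun v := ∑ A, tens (v A) (unitProd A * s)
  map_add' v w := by
    rw [← Finset.sum_add_distrib]
    refine Finset.sum_congr rfl fun A _ => ?_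
    ext C
    simp [tens]
  map_smul' r v := by
    rw [RingHom.id_apply, Finset.smul_sum]
    refine Finset.sum_congr rfl fun A _ => ?_
    ext C
    simp [tens, smul_comm r]

/-- The `ℝ_d`-valued inner product `⟨v, w⟩ = ∑ ⟨v_A, w_B⟩ conj(e_A) e_B`. -/
def cinner (v w : CMod d H) : Cl d :=
  ∑ A, ∑ B, (inner ℝ (v A) (w B) : ℝ) • (star (unitProd A) * unitProd B)

/-- The real inner product of `V` is the scalar part of the Clifford inner product. -/
lemma Sc_cinner (v w : CMod d H) : Sc (cinner v w) = inner ℝ v w := by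
  have h : ∀ A B : Finset (Fin d), (eBasis d).repr (star (unitProd A) * unitProd B) ∅
      = if A = B then 1 else 0 := Sc_star_unitProd_mul
  simp [Sc, coord, cinner, map_sum, Finsupp.finsetSum_apply, h, PiLp.inner_apply]

/-! ### Operators -/

/-- A partially defined operator is right-linear if its domain is stable under right multiplication
and `T (v s) = (T v) s`. -/
def IsRightLinear (T : CMod d H →ₗ.[ℝ] CMod d H) : Prop :=
  ∀ (s : Cl d) (v : T.domain), ∃ h : rightMul s (v : CMod d H) ∈ T.domain,
    T ⟨rightMul s v, h⟩ = rightMul s (T v)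

/-- `𝓚(V)`: the closed right-linear operators. -/
def closedOps (d : ℕ) (H : Type*) [NormedAddCommGroup H] [InnerProductSpace ℝ H] :
    Set (CMod d H →ₗ.[ℝ] CMod d H) :=
  {T | IsRightLinear T ∧ T.IsClosed}

/-- `𝓑(V)`: the bounded, everywhere defined right-linear operators. -/
def boundedOps (d : ℕ) (H : Type*) [NormedAddCommGroup H] [InnerProductSpace ℝ H] :
    Set (CMod d H →ₗ.[ℝ] CMod d H) :=
  {T | IsRightLinear T ∧ T.domain = ⊤ ∧ ∃ C : ℝ, ∀ v : T.domain, ‖T v‖ ≤ C * ‖(v : CMod d H)‖}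

/-- The product `S T` of two operators, with domain `{v ∈ dom T | T v ∈ dom S}`. -/
def opMul (S T : CMod d H →ₗ.[ℝ] CMod d H) : CMod d H →ₗ.[ℝ] CMod d H where
  domain := (S.domain.comap T.toFun).map T.domain.subtype
  toFun := S.toFun ∘ₗ
    { toFun := fun v => ⟨T ⟨v, (Submodule.map_subtype_le _ _) v.2⟩, by
        obtain ⟨_, w, hw, rfl⟩ := v
        exact hw⟩
      map_add' := fun v w => Subtype.ext (T.toFun.map_add
        ⟨v, (Submodule.map_subtype_le _ _) v.2⟩ ⟨w, (Submodule.map_subtype_le _ _) w.2⟩)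
      map_smul' := fun r v => Subtype.ext (T.toFun.map_smul r
        ⟨v, (Submodule.map_subtype_le _ _) v.2⟩) }

lemma mem_opMul_domain {S T : CMod d H →ₗ.[ℝ] CMod d H} {v : CMod d H} :
    v ∈ (opMul S T).domain ↔ ∃ h : v ∈ T.domain, T ⟨v, h⟩ ∈ S.domain := by
  simp [opMul]

lemma opMul_apply {S T : CMod d H →ₗ.[ℝ] CMod d H} {v : CMod d H} (h : v ∈ T.domain)
    (h' : T ⟨v, h⟩ ∈ S.domain) :
    opMul S T ⟨v, mem_opMul_domain.2 ⟨h, h'⟩⟩ = S ⟨T ⟨v, h⟩, h'⟩ := rfl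

/-- The everywhere defined operator of left multiplication by `s`. -/
def scalarOp (s : Cl d) : CMod d H →ₗ.[ℝ] CMod d H := (leftMul s).toPMap ⊤

/-- `Q_s[T] = T² - 2 s₀ T + |s|²`. -/
def Qop (s : Cl d) (T : CMod d H →ₗ.[ℝ] CMod d H) : CMod d H →ₗ.[ℝ] CMod d H :=
  opMul T T - (2 * Sc s) • T + modSq s • (LinearMap.id.toPMap ⊤)

/-- `Q_s[T]` has domain `dom(T²)`. -/
lemma Qop_domain (s : Cl d) (T : CMod d H →ₗ.[ℝ] CMod d H) :
    (Qop s T).domain = (opMul T T).domain := by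
  ext v
  simp only [Qop, LinearPMap.add_domain, LinearPMap.sub_domain, LinearPMap.smul_domain,
    LinearMap.toPMap_domain, Submodule.mem_inf, Submodule.mem_top, and_true,
    and_iff_left_iff_imp, mem_opMul_domain]
  exact fun h => h.1

/-- The `S`-resolvent set: the paravectors `s` for which `Q_s[T]` is injective with
`Q_s[T]⁻¹ ∈ 𝓑(V)`. -/
def rhoS (T : CMod d H →ₗ.[ℝ] CMod d H) : Set (Cl d) :=
  {s | s ∈ paravectors d ∧ LinearMap.ker (Qop s T).toFun = ⊥ ∧ (Qop s T).inverse ∈ boundedOps d H}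

/-- The `S`-spectrum. -/
def sigmaS (T : CMod d H →ₗ.[ℝ] CMod d H) : Set (Cl d) := paravectors d \ rhoS T

/-- The left `S`-resolvent operator `Q_s[T]⁻¹ conj(s) - T Q_s[T]⁻¹`. -/
def SL (s : Cl d) (T : CMod d H →ₗ.[ℝ] CMod d H) : CMod d H →ₗ.[ℝ] CMod d H :=
  opMul (Qop s T).inverse (scalarOp (star s)) - opMul T (Qop s T).inverse

/-- The right `S`-resolvent operator `(conj(s) - T) Q_s[T]⁻¹`. -/
def SR (s : Cl d) (T : CMod d H →ₗ.[ℝ] CMod d H) : CMod d H →ₗ.[ℝ] CMod d H :=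
  opMul (scalarOp (star s) - T) (Qop s T).inverse

/-- The adjoint of a densely defined operator with respect to `Sc⟨·, ·⟩`. -/
def adj [CompleteSpace H] (T : CMod d H →ₗ.[ℝ] CMod d H) : CMod d H →ₗ.[ℝ] CMod d H :=
  T.adjoint

/-- `w ∈ dom(T*)` iff some `u` satisfies `Sc⟨u, v⟩ = Sc⟨w, T v⟩` for all `v ∈ dom(T)`. -/
lemma mem_adj_domain [CompleteSpace H] {T : CMod d H →ₗ.[ℝ] CMod d H}
    (hT : Dense (T.domain : Set (CMod d H))) {w : CMod d H} :
    w ∈ (adj T).domain ↔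
      ∃ u : CMod d H, ∀ v : T.domain, Sc (cinner u (v : CMod d H)) = Sc (cinner w (T v)) := by
  simp only [Sc_cinner]
  exact ⟨fun h => ⟨T.adjoint ⟨w, h⟩, fun v => T.adjoint_isFormalAdjoint hT ⟨w, h⟩ v⟩,
    fun h => T.mem_adjoint_domain_of_exists w h⟩

/-- `Sc⟨T* w, v⟩ = Sc⟨w, T v⟩`. -/
lemma Sc_cinner_adj [CompleteSpace H] {T : CMod d H →ₗ.[ℝ] CMod d H}
    (hT : Dense (T.domain : Set (CMod d H))) (w : (adj T).domain) (v : T.domain) :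
    Sc (cinner (adj T w) (v : CMod d H)) = Sc (cinner (w : CMod d H) (T v)) := by
  simp only [Sc_cinner]
  exact T.adjoint_isFormalAdjoint hT w v

end Module

end CliffordS

end

/-!
Let `s ∈ ρ_S(T)`, write `Q = T² - 2 s₀ T + |s|²` and let `R = Q⁻¹`, a bounded operator. By the
closed graph theorem `T R` is bounded, hence so is `T² R = 1 + 2 s₀ T R - |s|² R`. Moreover
`R T ⊆ T R`. Pairing `R* w` with `T u` therefore gives `T* R* = (T R)*`, and pairing once more gives
`T*² R* = (T² R)*`, so that `Q_s[T*] R* = 1`. On the other hand `R* Q_s[T*] x = x` on `dom(T*²)`,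
because pairing `Q_s[T*] x` with `R v` moves everything to `⟨x, Q R v⟩ = ⟨x, v⟩`. Thus `R*` inverts
`Q_s[T*]` (`IsQuadInverse.adjoint`); no density of `dom(T²)` enters. Since `T** = T` for closed `T`
(`IsAdjointOf.symm`), `ρ_S(T) = ρ_S(T*)`.

The operator `Q_s[T]` depends on `s` only through `s₀` and `|s|²`, which conjugation preserves, so
`ρ_S(T)` is stable under conjugation. Finally, left multiplication by `s` has as adjoint left
multiplication by `conj(s)` (`adjoint_leftMulL`), so the two formulas for the `S`-resolvent
operators follow by taking adjoints of the bounded operators `s R - T R` and `R s - T R`, using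
`T* R* = (T R)*` (`IsQuadInverse.adjoint_comp`).

Unbounded operators are handled through their graphs, which avoids elements of domain subtypes.
-/

namespace CliffordS

open scoped InnerProductSpace

/-! ### Quadratic polynomials of closed operators and their adjoints -/

section Hilbert

variable {E : Type*} [NormedAddCommGroup E] [InnerProductSpace ℝ E]

/-- The bounded operator `R` is a two-sided inverse of `T² - a T + b`, where `T²` has its natural
domain. Values of `T` are expressed through membership in its graph. -/
structure IsQuadInverse (T : E →ₗ.[ℝ] E) (a b : ℝ) (R : E →L[ℝ] E) : Prop where
  right_inv : ∀ v, ∃ y z, (R v, y) ∈ T.graph ∧ (y, z) ∈ T.graph ∧ z - a • y + b • R v = v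
  left_inv : ∀ {x y z}, (x, y) ∈ T.graph → (y, z) ∈ T.graph → R (z - a • y + b • x) = x

/-- `S` is the adjoint of `T`, in terms of graphs. -/
def IsAdjointOf (S T : E →ₗ.[ℝ] E) : Prop :=
  ∀ x y, (x, y) ∈ S.graph ↔ ∀ u v, (u, v) ∈ T.graph → ⟪x, v⟫_ℝ = ⟪y, u⟫_ℝ

lemma isAdjointOf_adjoint [CompleteSpace E] {T : E →ₗ.[ℝ] E} (hT : Dense (T.domain : Set E)) :
    IsAdjointOf T.adjoint T := by
  intro x y
  rw [LinearPMap.adjoint_graph_eq_graph_adjoint hT, Submodule.mem_adjoint_iff]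
  simp only [sub_eq_zero, real_inner_comm]

/-- A closed operator is the adjoint of its adjoint: its graph is a closed subspace, hence equal to
its double orthogonal complement. -/
lemma IsAdjointOf.symm [CompleteSpace E] {S T : E →ₗ.[ℝ] E} (hT : T.IsClosed)
    (h : IsAdjointOf S T) : IsAdjointOf T S := by
  intro x y
  refine ⟨fun hxy u v huv => ?_, fun hxy => ?_⟩
  · rw [real_inner_comm, ← (h u v).1 huv x y hxy, real_inner_comm]
  · let G : Submodule ℝ (WithLp 2 (E × E)) :=
      T.graph.map (WithLp.linearEquiv 2 ℝ (E × E)).symm.toLinearMap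
    have hmem : ∀ p : WithLp 2 (E × E), p ∈ G ↔ (p.fst, p.snd) ∈ T.graph := by
      intro p
      simp only [G, Submodule.mem_map]
      constructor
      · rintro ⟨q, hq, rfl⟩
        exact hq
      · intro hp
        exact ⟨_, hp, rfl⟩
    have hG : IsClosed (G : Set (WithLp 2 (E × E))) := by
      have : (G : Set (WithLp 2 (E × E))) = WithLp.ofLp ⁻¹' (T.graph : Set (E × E)) := by
        ext p
        exact hmem p
      rw [this]
      exact IsClosed.preimage (WithLp.prod_continuous_ofLp _ _ _) hT
    have : CompleteSpace G := hG.completeSpace_coe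
    have key : WithLp.toLp 2 (x, y) ∈ Gᗮᗮ := by
      rw [Submodule.mem_orthogonal]
      intro p hp
      -- `(p₁, p₂)` is orthogonal to the graph of `T` iff `(p₂, -p₁)` is in the graph of its adjoint
      have hS : (p.snd, -p.fst) ∈ S.graph := by
        rw [h]
        intro u v huv
        have := (Submodule.mem_orthogonal _ _).1 hp (WithLp.toLp 2 (u, v)) ((hmem _).2 huv)
        rw [WithLp.prod_inner_apply] at this
        simp only [inner_neg_left] at this ⊢
        change ⟪u, p.fst⟫_ℝ + ⟪v, p.snd⟫_ℝ = 0 at this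
        rw [real_inner_comm, real_inner_comm u]
        linarith
      have := hxy _ _ hS
      rw [WithLp.prod_inner_apply]
      simp only [inner_neg_right] at this ⊢
      change ⟪p.fst, x⟫_ℝ + ⟪p.snd, y⟫_ℝ = 0
      rw [real_inner_comm x, real_inner_comm y]
      linarith
    rw [Submodule.orthogonal_orthogonal] at key
    exact (hmem _).1 key

lemma mem_graph_unique {T : E →ₗ.[ℝ] E} {x y y' : E} (h : (x, y) ∈ T.graph)
    (h' : (x, y') ∈ T.graph) : y = y' :=
  T.mem_graph_snd_inj h h' rfl

variable {T : E →ₗ.[ℝ] E} {a b : ℝ} {R : E →L[ℝ] E}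

/-- If `T² - a T + b` has the bounded inverse `R`, then `T R` is bounded, being closed and
everywhere defined. -/
lemma IsQuadInverse.exists_comp [CompleteSpace E] (hR : IsQuadInverse T a b R) (hT : T.IsClosed) :
    ∃ B : E →L[ℝ] E, ∀ v, (R v, B v) ∈ T.graph := by
  have hex : ∀ v, ∃ y, (R v, y) ∈ T.graph := fun v => by
    obtain ⟨y, _, hy, _⟩ := hR.right_inv v
    exact ⟨y, hy⟩
  choose f hf using hex
  let g : E →ₗ[ℝ] E :=
    { toFun := f
      map_add' := fun v w => mem_graph_unique (hf _) (by
        rw [map_add]; exact T.graph.add_mem (hf v) (hf w))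
      map_smul' := fun c v => mem_graph_unique (hf _) (by
        rw [map_smul]; exact T.graph.smul_mem c (hf v)) }
  have hg : IsClosed (g.graph : Set (E × E)) := by
    have : (g.graph : Set (E × E)) = (fun p : E × E => (R p.1, p.2)) ⁻¹' (T.graph : Set (E × E)) := by
      ext p
      simp only [SetLike.mem_coe, LinearMap.mem_graph_iff, Set.mem_preimage]
      exact ⟨fun h => by rw [h]; exact hf _, fun h => mem_graph_unique h (hf _)⟩
    rw [this]
    exact IsClosed.preimage (by fun_prop) hT
  exact ⟨⟨g, g.continuous_of_isClosed_graph hg⟩, hf⟩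

variable {B : E →L[ℝ] E}

lemma IsQuadInverse.mem_graph_comp (hR : IsQuadInverse T a b R) (hB : ∀ v, (R v, B v) ∈ T.graph)
    (v : E) : (B v, v + a • B v - b • R v) ∈ T.graph := by
  obtain ⟨y, z, hy, hz, hv⟩ := hR.right_inv v
  rw [mem_graph_unique (hB v) hy]
  convert hz using 2
  nth_rewrite 1 [← hv]
  abel

/-- The inverse of `T² - a T + b` commutes with `T`. -/
lemma IsQuadInverse.comp_comm (hR : IsQuadInverse T a b R) (hB : ∀ v, (R v, B v) ∈ T.graph)
    {x y : E} (hxy : (x, y) ∈ T.graph) : R y = B x := by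
  have h1 := hB x
  have h2 := hR.mem_graph_comp hB x
  have h3 : (x + a • B x - b • R x, y + a • (x + a • B x - b • R x) - b • B x) ∈ T.graph :=
    T.graph.sub_mem (T.graph.add_mem hxy (T.graph.smul_mem a h2)) (T.graph.smul_mem b h1)
  have h4 := hR.left_inv h2 h3
  rw [← h4]
  congr 1
  abel

variable [CompleteSpace E] {S : E →ₗ.[ℝ] E}

/-- If `R` inverts `T² - a T + b`, then `S R* = (T R)*` for the adjoint `S` of `T`. -/
lemma IsQuadInverse.adjoint_comp (hR : IsQuadInverse T a b R) (hB : ∀ v, (R v, B v) ∈ T.graph)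
    (hS : IsAdjointOf S T) (w : E) : (R.adjoint w, B.adjoint w) ∈ S.graph := by
  rw [hS]
  intro u v huv
  rw [ContinuousLinearMap.adjoint_inner_left, ContinuousLinearMap.adjoint_inner_left,
    hR.comp_comm hB huv]

/-- If `R` inverts `T² - a T + b`, then `R*` inverts `S² - a S + b` for the adjoint `S` of `T`.
No density of the domain of `T²` is needed. -/
lemma IsQuadInverse.adjoint (hR : IsQuadInverse T a b R) (hT : T.IsClosed)
    (hS : IsAdjointOf S T) : IsQuadInverse S a b R.adjoint := by
  obtain ⟨B, hB⟩ := hR.exists_comp hT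
  refine ⟨fun w => ⟨B.adjoint w, w + a • B.adjoint w - b • R.adjoint w,
    hR.adjoint_comp hB hS w, ?_, by abel⟩, fun {x y z} hxy hyz => ?_⟩
  · rw [hS]
    intro u v huv
    -- `T R T u = T² R u`, and `T² R = 1 + a T R - b R` is bounded
    have h : B v = u + a • B u - b • R u :=
      mem_graph_unique (hB v) (by rw [hR.comp_comm hB huv]; exact hR.mem_graph_comp hB u)
    simp only [inner_add_left, inner_sub_left, real_inner_smul_left,
      ContinuousLinearMap.adjoint_inner_left, h, inner_add_right, inner_sub_right,
      real_inner_smul_right]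
  · refine ext_inner_right ℝ fun v => ?_
    have h1 := (hS _ _).1 hxy _ _ (hB v)
    have h2 := (hS _ _).1 hyz _ _ (hB v)
    have h3 := (hS _ _).1 hxy _ _ (hR.mem_graph_comp hB v)
    rw [ContinuousLinearMap.adjoint_inner_left]
    simp only [inner_add_left, inner_sub_left, real_inner_smul_left, inner_add_right,
      inner_sub_right, real_inner_smul_right] at h1 h2 h3 ⊢
    linear_combination -h3 - h2 + a * h1

end Hilbert

/-! ### Conjugation and the scalar part -/

section Clifford

variable {d : ℕ}

lemma sum_coord_smul (s : Cl d) : ∑ A, coord A s • unitProd A = s := by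
  simpa [coord, eBasis_apply] using (eBasis d).sum_repr s

lemma Sc_sum_smul {ι : Type*} (I : Finset ι) (c : ι → ℝ) (s : ι → Cl d) :
    Sc (∑ i ∈ I, c i • s i) = ∑ i ∈ I, c i * Sc (s i) := by
  simp [Sc, coord, map_sum, Finsupp.finsetSum_apply]

lemma star_eq_sum (s : Cl d) : star s = ∑ A, coord A s • star (unitProd A) := by
  nth_rewrite 1 [← sum_coord_smul s]
  simp only [star_sum, CliffordAlgebra.star_smul]

lemma Sc_star_mul (s t : Cl d) : Sc (star s * t) = ∑ A, coord A s * coord A t := by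
  have h : star s * t = ∑ p : Finset (Fin d) × Finset (Fin d),
      (coord p.1 s * coord p.2 t) • (star (unitProd p.1) * unitProd p.2) := by
    nth_rewrite 1 [star_eq_sum s, ← sum_coord_smul t]
    rw [Finset.sum_mul_sum, ← Finset.univ_product_univ, Finset.sum_product]
    simp only [smul_mul_smul_comm]
  rw [h, Sc_sum_smul, ← Finset.univ_product_univ, Finset.sum_product]
  simp [Sc_star_unitProd_mul]

lemma Sc_star_mul_comm (s t : Cl d) : Sc (star s * t) = Sc (star t * s) := by
  simp only [Sc_star_mul, mul_comm]

lemma Sc_star (s : Cl d) : Sc (star s) = Sc s := by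
  have h := Sc_star_mul_comm s 1
  simpa using h

/-- The scalar part is a trace. -/
lemma Sc_mul_comm (s t : Cl d) : Sc (s * t) = Sc (t * s) := by
  have h : ∀ A B : Finset (Fin d), Sc (unitProd A * unitProd B : Cl d)
      = Sc (unitProd B * unitProd A : Cl d) := by
    intro A B
    rw [← Sc_star, star_mul, star_unitProd A, mul_smul_comm]
    have h1 : ∀ (c : ℝ) (u : Cl d), Sc (c • u) = c * Sc u := fun c u => by simp [Sc, coord]
    by_cases hAB : A = B
    · subst hAB
      rw [star_unitProd, smul_mul_assoc, h1, h1, ← mul_assoc, ← mul_pow]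
      simp
    -- for `A ≠ B` both scalar parts vanish, by orthogonality of the basis up to signs
    · have h2 : Sc (star (unitProd B) * unitProd A : Cl d) = 0 := by
        rw [Sc_star_unitProd_mul, if_neg (Ne.symm hAB)]
      rw [h1, h2]
      rw [star_unitProd, smul_mul_assoc, h1] at h2
      rcases mul_eq_zero.1 h2 with h3 | h3
      · exact absurd h3 (by positivity)
      · rw [h3, mul_zero]
  have hexp : ∀ s t : Cl d, s * t = ∑ p : Finset (Fin d) × Finset (Fin d),
      (coord p.1 s * coord p.2 t) • (unitProd p.1 * unitProd p.2) := by
    intro s t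
    nth_rewrite 1 [← sum_coord_smul s, ← sum_coord_smul t]
    rw [Finset.sum_mul_sum, ← Finset.univ_product_univ, Finset.sum_product]
    simp only [smul_mul_smul_comm]
  rw [hexp s t, hexp t s, Sc_sum_smul, Sc_sum_smul, ← Finset.univ_product_univ,
    Finset.sum_product, Finset.sum_product_right]
  refine Finset.sum_congr rfl fun A _ => Finset.sum_congr rfl fun B _ => ?_
  rw [h A B, mul_comm (coord A s)]

lemma modSq_star (s : Cl d) : modSq (star s) = modSq s := by
  have h : ∀ t : Cl d, modSq t = Sc (star t * t) := fun t => by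
    simp only [modSq, Sc_star_mul, sq]
  rw [h, h, star_star, Sc_mul_comm]

lemma star_mem_paravectors {s : Cl d} (hs : s ∈ paravectors d) : star s ∈ paravectors d := by
  obtain ⟨s₀, x, rfl⟩ := hs
  refine ⟨s₀, -x, ?_⟩
  simp [star_sum, CliffordAlgebra.star_smul, unit]

end Clifford

/-! ### Left and right multiplication on the Hilbert module -/

section Module

variable {d : ℕ} {H : Type*} [NormedAddCommGroup H] [InnerProductSpace ℝ H]

/-- The elements `x ⊗ s` and `y ⊗ t` pair to `Sc(conj(s) t) ⟨x, y⟩`. -/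
lemma inner_tens (x y : H) (s t : Cl d) :
    ⟪tens x s, (tens y t : CMod d H)⟫_ℝ = Sc (star s * t) * ⟪x, y⟫_ℝ := by
  simp only [tens, PiLp.inner_apply, real_inner_smul_left, real_inner_smul_right, Sc_star_mul,
    Finset.sum_mul]
  exact Finset.sum_congr rfl fun C _ => by ring

lemma sum_tens (v : CMod d H) : ∑ A, tens (v A) (unitProd A) = v := by
  ext C
  simp [tens, coord_unitProd]

lemma inner_leftMul (s : Cl d) (v w : CMod d H) :
    ⟪leftMul s v, w⟫_ℝ = ⟪v, leftMul (star s) w⟫_ℝ := by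
  conv_lhs => rw [← sum_tens w]
  conv_rhs => rw [← sum_tens v]
  simp only [leftMul, LinearMap.coe_mk, AddHom.coe_mk, sum_inner, inner_sum, inner_tens, star_mul,
    mul_assoc]

/-- Right multiplication by `conj(s)` is adjoint to that by `s`, because the scalar part is a
trace. -/
lemma inner_rightMul (s : Cl d) (v w : CMod d H) :
    ⟪rightMul s v, w⟫_ℝ = ⟪v, rightMul (star s) w⟫_ℝ := by
  conv_lhs => rw [← sum_tens w]
  conv_rhs => rw [← sum_tens v]
  simp only [rightMul, LinearMap.coe_mk, AddHom.coe_mk, sum_inner, inner_sum, inner_tens, star_mul]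
  refine Finset.sum_congr rfl fun A _ => Finset.sum_congr rfl fun B _ => ?_
  rw [mul_assoc, Sc_mul_comm, mul_assoc]

/-- Left multiplication by `s` as a bounded operator. -/
noncomputable def leftMulL (s : Cl d) : CMod d H →L[ℝ] CMod d H where
  toLinearMap := leftMul s
  cont := by
    simp only [leftMul, tens]
    change Continuous fun v : CMod d H => ∑ A, WithLp.toLp 2 fun C => coord C (s * unitProd A) • v A
    fun_prop

lemma adjoint_leftMulL [CompleteSpace H] (s : Cl d) :
    (leftMulL s : CMod d H →L[ℝ] CMod d H).adjoint = leftMulL (star s) := by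
  symm
  rw [ContinuousLinearMap.eq_adjoint_iff]
  intro v w
  change ⟪leftMul (star s) v, w⟫_ℝ = ⟪v, leftMul s w⟫_ℝ
  rw [inner_leftMul, star_star]

/-! ### Resolvents on the Hilbert module -/

variable {T : CMod d H →ₗ.[ℝ] CMod d H} {s : Cl d} {R B : CMod d H →L[ℝ] CMod d H}

lemma isRightLinear_iff : IsRightLinear T ↔
    ∀ (s : Cl d) (x y : CMod d H), (x, y) ∈ T.graph → (rightMul s x, rightMul s y) ∈ T.graph := by
  constructor
  · intro h s x y hxy
    obtain ⟨v, rfl, rfl⟩ := T.mem_graph_iff.1 hxy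
    obtain ⟨h1, h2⟩ := h s v
    rw [← h2]
    exact T.mem_graph ⟨_, h1⟩
  · intro h s v
    obtain ⟨w, h1, h2⟩ := T.mem_graph_iff.1 (h s _ _ (T.mem_graph v))
    simp only at h1 h2
    refine ⟨h1 ▸ w.2, ?_⟩
    rw [← h2]
    congr 1
    exact Subtype.ext h1.symm

lemma IsRightLinear.of_isAdjointOf {S : CMod d H →ₗ.[ℝ] CMod d H} (hT : IsRightLinear T)
    (hS : IsAdjointOf S T) : IsRightLinear S := by
  rw [isRightLinear_iff] at hT ⊢
  intro s x y hxy
  rw [hS] at hxy ⊢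
  intro u v huv
  rw [inner_rightMul, inner_rightMul]
  exact hxy _ _ (hT _ _ _ huv)

lemma mem_graph_Qop {x w : CMod d H} : (x, w) ∈ (Qop s T).graph ↔
    ∃ y z, (x, y) ∈ T.graph ∧ (y, z) ∈ T.graph ∧ z - (2 * Sc s) • y + modSq s • x = w := by
  constructor
  · intro h
    obtain ⟨⟨v, hv⟩, h1, h2⟩ := LinearPMap.mem_graph_iff _ |>.1 h
    simp only at h1 h2
    subst h1
    obtain ⟨h3, h4⟩ := mem_opMul_domain.1 (Qop_domain s T ▸ hv)
    exact ⟨T ⟨v, h3⟩, T ⟨_, h4⟩, T.mem_graph ⟨v, h3⟩, T.mem_graph ⟨_, h4⟩, h2⟩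
  · rintro ⟨y, z, hxy, hyz, rfl⟩
    obtain ⟨⟨v, hv⟩, h1, h2⟩ := LinearPMap.mem_graph_iff _ |>.1 hxy
    obtain ⟨⟨u, hu⟩, h3, h4⟩ := LinearPMap.mem_graph_iff _ |>.1 hyz
    simp only at h1 h2 h3 h4
    subst h1 h3 h4 h2
    have hdom : v ∈ (Qop s T).domain := by
      rw [Qop_domain]
      exact mem_opMul_domain.2 ⟨hv, hu⟩
    exact (Qop s T).mem_graph ⟨v, hdom⟩

lemma toPMap_graph {x y : CMod d H} :
    (x, y) ∈ ((R : CMod d H →ₗ[ℝ] CMod d H).toPMap ⊤).graph ↔ R x = y := by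
  rw [LinearPMap.mem_graph_iff]
  constructor
  · rintro ⟨v, rfl, rfl⟩
    rfl
  · rintro rfl
    exact ⟨⟨x, trivial⟩, rfl, rfl⟩

lemma eq_toPMap_of_graph (h : ∀ v, (v, R v) ∈ T.graph) :
    T = (R : CMod d H →ₗ[ℝ] CMod d H).toPMap ⊤ := by
  refine LinearPMap.eq_of_eq_graph ?_
  ext ⟨x, y⟩
  rw [toPMap_graph]
  exact ⟨fun hxy => mem_graph_unique (h x) hxy, fun hxy => hxy ▸ h x⟩

lemma IsQuadInverse.ker_Qop (hR : IsQuadInverse T (2 * Sc s) (modSq s) R) :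
    LinearMap.ker (Qop s T).toFun = ⊥ := by
  rw [LinearMap.ker_eq_bot']
  intro v hv
  have h := (Qop s T).mem_graph v
  have h0 : Qop s T v = 0 := hv
  rw [h0] at h
  obtain ⟨y, z, h1, h2, h3⟩ := mem_graph_Qop.1 h
  have := hR.left_inv h1 h2
  rw [h3, map_zero] at this
  exact Subtype.ext this.symm

lemma IsQuadInverse.inverse_Qop (hR : IsQuadInverse T (2 * Sc s) (modSq s) R) :
    (Qop s T).inverse = (R : CMod d H →ₗ[ℝ] CMod d H).toPMap ⊤ := by
  refine eq_toPMap_of_graph fun v => ?_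
  rw [LinearPMap.inverse_graph hR.ker_Qop]
  exact ⟨(R v, v), mem_graph_Qop.2 (hR.right_inv v), rfl⟩

/-- Right-linearity of the inverse of `Q_s[T]` is inherited from `T`. -/
lemma IsQuadInverse.mem_rhoS (hR : IsQuadInverse T (2 * Sc s) (modSq s) R)
    (hs : s ∈ paravectors d) (hT : IsRightLinear T) : s ∈ rhoS T := by
  refine ⟨hs, hR.ker_Qop, ?_⟩
  rw [hR.inverse_Qop]
  refine ⟨?_, rfl, ‖R‖, fun v => R.le_opNorm v⟩
  rw [isRightLinear_iff] at hT ⊢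
  intro t x y hxy
  rw [toPMap_graph] at hxy ⊢
  subst hxy
  obtain ⟨y, z, h1, h2, h3⟩ := hR.right_inv x
  have := hR.left_inv (hT t _ _ h1) (hT t _ _ h2)
  rw [← this]
  nth_rewrite 1 [← h3]
  simp only [map_add, map_sub, map_smul]

lemma exists_isQuadInverse (hs : s ∈ rhoS T) :
    ∃ R : CMod d H →L[ℝ] CMod d H, IsQuadInverse T (2 * Sc s) (modSq s) R := by
  obtain ⟨-, hker, -, hdom, C, hC⟩ := hs
  have hmem : ∀ v, v ∈ (Qop s T).inverse.domain := fun v => hdom ▸ Submodule.mem_top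
  let R : CMod d H →L[ℝ] CMod d H := LinearMap.mkContinuous
    { toFun := fun v => (Qop s T).inverse ⟨v, hmem v⟩
      map_add' := fun v w => (Qop s T).inverse.map_add ⟨v, hmem v⟩ ⟨w, hmem w⟩
      map_smul' := fun c v => (Qop s T).inverse.map_smul c ⟨v, hmem v⟩ } C
    fun v => hC ⟨v, hmem v⟩
  have hgraph : ∀ {x w}, (x, w) ∈ (Qop s T).graph ↔ R w = x := by
    intro x w
    have h1 : (x, w) ∈ (Qop s T).graph ↔ (w, x) ∈ (Qop s T).inverse.graph := by
      rw [LinearPMap.inverse_graph hker]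
      constructor
      · exact fun h => ⟨_, h, rfl⟩
      · rintro ⟨⟨p, q⟩, h, h2⟩
        obtain ⟨rfl, rfl⟩ := Prod.mk.inj h2
        exact h
    rw [h1]
    have h2 : (w, R w) ∈ (Qop s T).inverse.graph := (Qop s T).inverse.mem_graph ⟨w, hmem w⟩
    exact ⟨fun h => mem_graph_unique h2 h, fun h => h ▸ h2⟩
  exact ⟨R, fun v => mem_graph_Qop.1 (hgraph.2 rfl),
    fun h1 h2 => hgraph.1 (mem_graph_Qop.2 ⟨_, _, h1, h2, rfl⟩)⟩

lemma mem_graph_opMul {S T : CMod d H →ₗ.[ℝ] CMod d H} {x y z : CMod d H}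
    (hxy : (x, y) ∈ T.graph) (hyz : (y, z) ∈ S.graph) : (x, z) ∈ (opMul S T).graph := by
  obtain ⟨⟨v, hv⟩, h1, h2⟩ := LinearPMap.mem_graph_iff _ |>.1 hxy
  obtain ⟨⟨u, hu⟩, h3, h4⟩ := LinearPMap.mem_graph_iff _ |>.1 hyz
  simp only at h1 h2 h3 h4
  subst h1 h3 h4 h2
  exact (opMul S T).mem_graph ⟨v, mem_opMul_domain.2 ⟨hv, hu⟩⟩

lemma mem_graph_sub {S T : CMod d H →ₗ.[ℝ] CMod d H} {x y z : CMod d H}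
    (hxy : (x, y) ∈ S.graph) (hxz : (x, z) ∈ T.graph) : (x, y - z) ∈ (S - T).graph := by
  obtain ⟨⟨v, hv⟩, h1, h2⟩ := LinearPMap.mem_graph_iff _ |>.1 hxy
  obtain ⟨⟨u, hu⟩, h3, h4⟩ := LinearPMap.mem_graph_iff _ |>.1 hxz
  simp only at h1 h2 h3 h4
  subst h1 h3 h4 h2
  exact (S - T).mem_graph ⟨u, hv, hu⟩

lemma mem_graph_scalarOp (s : Cl d) (x : CMod d H) :
    (x, leftMulL s x) ∈ (scalarOp s : CMod d H →ₗ.[ℝ] CMod d H).graph :=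
  (scalarOp s).mem_graph ⟨x, trivial⟩

lemma IsQuadInverse.SL_eq (hR : IsQuadInverse T (2 * Sc s) (modSq s) R)
    (hB : ∀ v, (R v, B v) ∈ T.graph) : SL s T =
      ((R ∘L leftMulL (star s) - B : CMod d H →L[ℝ] CMod d H) :
        CMod d H →ₗ[ℝ] CMod d H).toPMap ⊤ := by
  refine eq_toPMap_of_graph fun v => ?_
  rw [SL, hR.inverse_Qop]
  exact mem_graph_sub (mem_graph_opMul (mem_graph_scalarOp _ _) (toPMap_graph.2 rfl))
    (mem_graph_opMul (toPMap_graph.2 rfl) (hB v))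

lemma IsQuadInverse.SR_eq (hR : IsQuadInverse T (2 * Sc s) (modSq s) R)
    (hB : ∀ v, (R v, B v) ∈ T.graph) : SR s T =
      ((leftMulL (star s) ∘L R - B : CMod d H →L[ℝ] CMod d H) :
        CMod d H →ₗ[ℝ] CMod d H).toPMap ⊤ := by
  refine eq_toPMap_of_graph fun v => ?_
  rw [SR, hR.inverse_Qop]
  exact mem_graph_opMul (toPMap_graph.2 rfl) (mem_graph_sub (mem_graph_scalarOp _ _) (hB v))

lemma adj_toPMap [CompleteSpace H] (A : CMod d H →L[ℝ] CMod d H) :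
    adj ((A : CMod d H →ₗ[ℝ] CMod d H).toPMap ⊤) =
      (A.adjoint : CMod d H →ₗ[ℝ] CMod d H).toPMap ⊤ :=
  A.toPMap_adjoint_eq_adjoint_toPMap_of_dense dense_univ

/-- The `S`-resolvent set passes from a closed right-linear operator to its adjoint. -/
lemma rhoS_subset_of_isAdjointOf [CompleteSpace H] {S : CMod d H →ₗ.[ℝ] CMod d H}
    (hT : T ∈ closedOps d H) (hS : IsAdjointOf S T) : rhoS T ⊆ rhoS S := by
  intro s hs
  obtain ⟨R, hR⟩ := exists_isQuadInverse hs
  exact (hR.adjoint hT.2 hS).mem_rhoS hs.1 (hT.1.of_isAdjointOf hS)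

end Module

end CliffordS

theorem mainTheorem1 (d : ℕ) (H : Type*) [NormedAddCommGroup H] [InnerProductSpace ℝ H]
    [CompleteSpace H] (T : CliffordS.CMod d H →ₗ.[ℝ] CliffordS.CMod d H)
    (hT : T ∈ CliffordS.closedOps d H) (hdense : Dense (T.domain : Set (CliffordS.CMod d H))) :
    CliffordS.sigmaS (CliffordS.adj T) = CliffordS.sigmaS T ∧
    ∀ s ∈ CliffordS.rhoS (CliffordS.adj T), star s ∈ CliffordS.rhoS T ∧
      CliffordS.SL s (CliffordS.adj T) = CliffordS.adj (CliffordS.SR (star s) T) ∧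
      CliffordS.SR s (CliffordS.adj T) = CliffordS.adj (CliffordS.SL (star s) T) := by
  have hS : CliffordS.IsAdjointOf (CliffordS.adj T) T := CliffordS.isAdjointOf_adjoint hdense
  have hclosed : CliffordS.adj T ∈ CliffordS.closedOps d H :=
    ⟨hT.1.of_isAdjointOf hS, LinearPMap.adjoint_isClosed hdense⟩
  have hrho : CliffordS.rhoS (CliffordS.adj T) = CliffordS.rhoS T :=
    (CliffordS.rhoS_subset_of_isAdjointOf hclosed (hS.symm hT.2)).antisymm
      (CliffordS.rhoS_subset_of_isAdjointOf hT hS)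
  refine ⟨by rw [CliffordS.sigmaS, hrho, CliffordS.sigmaS], fun s hs => ?_⟩
  rw [hrho] at hs
  obtain ⟨R, hR⟩ := CliffordS.exists_isQuadInverse hs
  obtain ⟨B, hB⟩ := hR.exists_comp hT.2
  have hR' := hR.adjoint hT.2 hS
  have hB' := hR.adjoint_comp hB hS
  have hRs : CliffordS.IsQuadInverse T (2 * CliffordS.Sc (star s)) (CliffordS.modSq (star s)) R := by
    rwa [CliffordS.Sc_star, CliffordS.modSq_star]
  refine ⟨hRs.mem_rhoS (CliffordS.star_mem_paravectors hs.1) hT.1, ?_, ?_⟩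
  · rw [hR'.SL_eq hB', hRs.SR_eq hB, CliffordS.adj_toPMap, map_sub,
      ContinuousLinearMap.adjoint_comp, CliffordS.adjoint_leftMulL, star_star]
  · rw [hR'.SR_eq hB', hRs.SL_eq hB, CliffordS.adj_toPMap, map_sub,
      ContinuousLinearMap.adjoint_comp, CliffordS.adjoint_leftMulL, star_star]
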